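/- Let $n,\theta\ge 1$ be integers and let $f:[n]\times[\theta]\to[n]$ be generic: for every $y\in[n]$ and all $x_1\ne x_2$ in $[n]$ the sets $\{e: f(x_1,e)=y\}$ and $\{e: f(x_2,e)=y\}$ are different, and for all $x,y\in[n]$ the set $\{e: f(x,e)=y\}$ is nonempty. Draw probability vectors $p$ on $[n]$ and $q$ on $[\theta]$ independently, each uniformly from the standard simplex of probability vectors (of dimension $n-1$, respectively $\theta-1$). Then, with probability $1$ over the draw of $(p,q)$, the following holds. Let $X$ and $E_0$ be independent random variables with distributions $p$ and $q$, and let $Y=f(X,E_0)$. Let $(X',Y')$ be any pair of random variables, on any probability space, with the same joint distribution as $(X,Y)$ (in particular $(X',Y')=(X,Y)$ is allowed), and let $\tilde E$ be a random variable on that space that is independent of $Y'$ and satisfies $X'=g(Y',\tilde E)$ almost surely for some deterministic function $g$. Then $\tilde E$ has at least $n(n-1)$ states: every set that contains the value of $\tilde E$ almost surely has at least $n(n-1)$ elements. -/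

import Mathlib

open MeasureTheory ProbabilityTheory

/-- The set of probability vectors with `m` entries, i.e. the `(m - 1)`-dimensional standard
simplex in the Euclidean space `ℝ^m`. -/
def probSimplex (m : ℕ) : Set (EuclideanSpace ℝ (Fin m)) :=
  {p | (∀ i, 0 ≤ p i) ∧ ∑ i, p i = 1}

/-- The uniform distribution on the standard simplex: the `(m - 1)`-dimensional Hausdorff measure
(that is, surface measure up to a constant factor), restricted to the simplex and normalised to
total mass one. -/
noncomputable def uniformSimplex (m : ℕ) : Measure (EuclideanSpace ℝ (Fin m)) :=
  ProbabilityTheory.cond (Measure.hausdorffMeasure ((m : ℝ) - 1)) (probSimplex m)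

/-- `f` is generic: for every `y`, the fibres `f_x⁻¹(y) = {e | f x e = y}` are pairwise different
for different `x`, and all the fibres are nonempty. -/
def IsGeneric {A E B : Type*} (f : A → E → B) : Prop :=
  (∀ x₁ x₂ : A, x₁ ≠ x₂ → ∀ y : B, {e | f x₁ e = y} ≠ {e | f x₂ e = y}) ∧
    ∀ (x : A) (y : B), {e | f x e = y}.Nonempty

/-- The random variables `C` (cause), `U` (exogenous variable) and `D` (effect) on the probability
space `(Ω, P)` form a causal model `C → D` with mechanism `f`: `U` is independent of `C`, and
`D = f(C, U)` almost surely. -/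
structure IsCausalModel {Ω A E B : Type*} [MeasurableSpace Ω] [MeasurableSpace A]
    [MeasurableSpace E] [MeasurableSpace B] (P : Measure Ω)
    (C : Ω → A) (U : Ω → E) (D : Ω → B) (f : A → E → B) : Prop where
  measurable_cause : Measurable C
  measurable_exogenous : Measurable U
  measurable_effect : Measurable D
  indep : IndepFun C U P
  effect_eq : ∀ᵐ ω ∂P, D ω = f (C ω) (U ω)

/-- The random variable `X` with values in `{0, …, m - 1}` has distribution vector `p`. -/
def HasDistribution {Ω : Type*} [MeasurableSpace Ω] {m : ℕ} (P : Measure Ω) (X : Ω → Fin m)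
    (p : EuclideanSpace ℝ (Fin m)) : Prop :=
  ∀ i, P.real {ω | X ω = i} = p i

/-! A state `e` of the reverse noise acts only through the map `y ↦ g y e`, so the conditional law
of `X'` given `Y'` is a convex combination of 0/1 matrices, one per state. With fewer than `n (n -
1)` states, dimension counting gives a rational `w` with a nonconstant column that annihilates all
these matrices (`exists_relation`), hence also the conditional law. Cleared of denominators, this is
a polynomial equation in `p` with coefficients depending on `q`.

There are only countably many rational `w`, so it is enough that each equation fails almost surely.
For almost every `q`, genericity makes the fibre masses nondegenerate; then a point where a single
denominator vanishes shows that the polynomial is not identically zero on the hyperplane of the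
simplex (`IsNondegenerate.exists_clearedRelation_ne_zero`), so its zeros in the simplex are null. -/

/-- The zero set of a nonzero real polynomial is a Lebesgue null set. -/
theorem MvPolynomial.volume_zeros_eq_zero {d : ℕ} (P : MvPolynomial (Fin d) ℝ) (hP : P ≠ 0) :
    volume {z : Fin d → ℝ | MvPolynomial.eval z P = 0} = 0 := by
  induction d with
  | zero =>
    have h : {z : Fin 0 → ℝ | MvPolynomial.eval z P = 0} = ∅ := by
      ext z
      simp only [Set.mem_ofPred_eq, Set.mem_empty_iff_false, iff_false]
      intro hz
      apply hP
      apply MvPolynomial.funext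
      intro z'
      rw [Subsingleton.elim z' z, hz, map_zero]
    rw [h, measure_empty]
  | succ d ih =>
    have hQ : MvPolynomial.finSuccEquiv ℝ d P ≠ 0 := by simpa using hP
    obtain ⟨i, hi⟩ : ∃ i, (MvPolynomial.finSuccEquiv ℝ d P).coeff i ≠ 0 := by
      by_contra! h
      exact hQ (Polynomial.ext (by simpa using h))
    set s : Set (ℝ × (Fin d → ℝ)) :=
      {ts | MvPolynomial.eval (Fin.cons ts.1 ts.2 : Fin (d + 1) → ℝ) P = 0} with hs
    have hcont : Continuous fun ts : ℝ × (Fin d → ℝ) =>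
        MvPolynomial.eval (Fin.cons ts.1 ts.2 : Fin (d + 1) → ℝ) P :=
      (MvPolynomial.continuous_eval P).comp (by fun_prop)
    have hmeas : MeasurableSet s := (isClosed_singleton.preimage hcont).measurableSet
    have hnull : (volume : Measure (ℝ × (Fin d → ℝ))) s = 0 := by
      rw [Measure.volume_eq_prod, Measure.prod_apply_symm hmeas]
      refine lintegral_eq_zero_of_ae_eq_zero ?_
      have hcoeff := ih _ hi
      rw [← compl_compl {z | _}, ← mem_ae_iff] at hcoeff
      -- Fubini: off the null set where the chosen coefficient vanishes, the slice over `z` consists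
      -- of the roots of a nonzero univariate polynomial.
      filter_upwards [hcoeff] with z hz
      set Q := Polynomial.map (MvPolynomial.eval z) (MvPolynomial.finSuccEquiv ℝ d P) with hQz
      have hQ0 : Q ≠ 0 := by
        intro h
        apply hz
        rw [Set.mem_ofPred_eq, ← Polynomial.coeff_map, ← hQz, h, Polynomial.coeff_zero]
      refine (Set.Finite.subset Q.roots.toFinset.finite_toSet fun t ht => ?_).measure_zero _
      have ht' : MvPolynomial.eval (Fin.cons t z : Fin (d + 1) → ℝ) P = 0 := ht
      rw [MvPolynomial.eval_eq_eval_mv_eval'] at ht'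
      simpa [hQ0] using ht'
    have hpre : {z : Fin (d + 1) → ℝ | MvPolynomial.eval z P = 0} =
        (MeasurableEquiv.piFinSuccAbove (fun _ => ℝ) 0) ⁻¹' s := by
      ext z
      simp [hs, MeasurableEquiv.piFinSuccAbove, Fin.insertNthEquiv]
    rw [hpre, (volume_preserving_piFinSuccAbove (fun _ => ℝ) 0).measure_preimage
      hmeas.nullMeasurableSet]
    exact hnull

/-- A polynomial that does not vanish identically on the hyperplane spanned by the simplex is
almost surely nonzero on the simplex. -/
theorem MvPolynomial.ae_uniformSimplex_eval_ne_zero {m : ℕ} (P : MvPolynomial (Fin m) ℝ)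
    (q₀ : Fin m → ℝ) (hsum : ∑ i, q₀ i = 1) (hq₀ : MvPolynomial.eval q₀ P ≠ 0) :
    ∀ᵐ q ∂(uniformSimplex m), MvPolynomial.eval (fun i => q i) P ≠ 0 := by
  cases m with
  | zero => simp at hsum
  | succ d =>
    have hcone : ∀ q : Fin (d + 1) → ℝ, ∑ i, q i = 1 →
        (Fin.cons (1 - ∑ i, q (Fin.succ i)) (fun i => q (Fin.succ i)) : Fin (d + 1) → ℝ) = q := by
      intro q hq
      rw [Fin.sum_univ_succ] at hq
      ext i
      refine Fin.cases ?_ (fun j => ?_) i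
      · simp; linarith
      · simp
    -- `R` is `P` in the affine chart of the hyperplane that solves for coordinate `0`; the chart
    -- `φ` is Lipschitz, so it preserves null sets.
    set R : MvPolynomial (Fin d) ℝ := MvPolynomial.bind₁
      (Fin.cons (1 - ∑ i, MvPolynomial.X i) MvPolynomial.X : Fin (d + 1) → _) P with hR
    have hReval : ∀ z : Fin d → ℝ, MvPolynomial.eval z R =
        MvPolynomial.eval (Fin.cons (1 - ∑ i, z i) z : Fin (d + 1) → ℝ) P := by
      intro z
      rw [hR, MvPolynomial.eval, MvPolynomial.eval₂Hom_bind₁]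
      congr 2
      ext i
      refine Fin.cases ?_ (fun j => ?_) i <;> simp
    have hR0 : R ≠ 0 := by
      intro h
      apply hq₀
      rw [← hcone q₀ hsum, ← hReval, h, map_zero]
    let φ : (Fin d → ℝ) → EuclideanSpace ℝ (Fin (d + 1)) := fun z =>
      WithLp.toLp 2 (Fin.cons (1 - ∑ i, z i) z)
    have hφ : ∃ K, LipschitzWith K φ := by
      let A : (Fin d → ℝ) →ₗ[ℝ] EuclideanSpace ℝ (Fin (d + 1)) :=
        { toFun := fun z => WithLp.toLp 2 (Fin.cons (- ∑ i, z i) z)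
          map_add' := by
            intro z z'
            ext i
            refine Fin.cases ?_ (fun j => ?_) i <;> simp [Finset.sum_add_distrib]; ring
          map_smul' := by
            intro c z
            ext i
            refine Fin.cases ?_ (fun j => ?_) i <;> simp [Finset.mul_sum] }
      refine ⟨_, LipschitzWith.of_dist_le_mul (K := ‖LinearMap.toContinuousLinearMap A‖₊) ?_⟩
      intro z z'
      have h : φ z - φ z' = LinearMap.toContinuousLinearMap A z -
          LinearMap.toContinuousLinearMap A z' := by
        ext i
        refine Fin.cases ?_ (fun j => ?_) i <;> simp [φ, A]; ring
      rw [dist_eq_norm, h, ← dist_eq_norm]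
      exact (LinearMap.toContinuousLinearMap A).lipschitz.dist_le_mul z z'
    obtain ⟨K, hK⟩ := hφ
    have hnull : Measure.hausdorffMeasure ((d : ℕ) : ℝ)
        (φ '' {z | MvPolynomial.eval z R = 0}) = 0 := by
      refine le_antisymm ((hK.hausdorffMeasure_image_le (Nat.cast_nonneg d) _).trans ?_) zero_le
      have := hausdorffMeasure_pi_real (ι := Fin d)
      rw [Fintype.card_fin] at this
      rw [this, MvPolynomial.volume_zeros_eq_zero R hR0, mul_zero]
    have hcl : IsClosed (probSimplex (d + 1)) := by
      have : probSimplex (d + 1) = (⋂ i, {p | 0 ≤ p i}) ∩ {p | ∑ i, p i = 1} := by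
        ext p; simp [probSimplex]
      rw [this]
      refine IsClosed.inter (isClosed_iInter fun i => isClosed_le (by fun_prop) (by fun_prop))
        (isClosed_eq (by fun_prop) (by fun_prop))
    unfold uniformSimplex ProbabilityTheory.cond
    apply Measure.ae_smul_measure
    rw [ae_restrict_iff' hcl.measurableSet, ae_iff]
    have hexp : ((d + 1 : ℕ) : ℝ) - 1 = (d : ℝ) := by push_cast; ring
    rw [hexp]
    refine measure_mono_null ?_ hnull
    intro q hq
    simp only [Set.mem_ofPred_eq, Classical.not_imp, not_not] at hq
    refine ⟨fun i => q (Fin.succ i), ?_, ?_⟩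
    · rw [Set.mem_ofPred_eq, hReval, hcone _ hq.1.2]
      exact hq.2
    · ext i
      exact congrFun (hcone _ hq.1.2) i

/-! ### Avoiding finitely many hyperplanes -/

/-- A real vector space is not a finite union of proper subspaces. Each `b i` is nonzero on the
kernel of `a`, as a vector supported on `x₁` and `x₂` shows. -/
theorem exists_sum_eq_zero_forall_sum_ne_zero {α ι : Type*} [Fintype α] [DecidableEq α] [Finite ι]
    (a : α → ℝ) (b : ι → α → ℝ) (h : ∀ i, ∃ x₁ x₂, a x₁ * b i x₂ ≠ a x₂ * b i x₁) :
    ∃ v : α → ℝ, ∑ x, v x * a x = 0 ∧ ∀ i, ∑ x, v x * b i x ≠ 0 := by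
  obtain ⟨v, hv, hb⟩ := Module.Dual.exists_forall_mem_ne_zero_of_forall_exists
    (LinearMap.ker (Fintype.linearCombination ℝ a)) (f := fun i => Fintype.linearCombination ℝ (b i))
    (by
      intro i
      obtain ⟨x₁, x₂, hx⟩ := h i
      refine ⟨Pi.single x₁ (a x₂) - Pi.single x₂ (a x₁), ?_, ?_⟩
      · simp [Fintype.linearCombination_apply_single]
        ring
      · simp only [map_sub, Fintype.linearCombination_apply_single, smul_eq_mul]
        intro h0
        exact hx (by linarith))
  exact ⟨v, by simpa [Fintype.linearCombination_apply] using hv,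
    fun i => by simpa [Fintype.linearCombination_apply] using hb i⟩

/-- If no functional in a finite family is proportional to `a`, some vector with entries summing
to one is annihilated by `a` but by none of the family. -/
theorem exists_sum_eq_one_sum_eq_zero_forall_sum_ne_zero {α ι : Type*} [Fintype α] [DecidableEq α]
    [Finite ι] (a : α → ℝ) (b : ι → α → ℝ) (h : ∀ i, ∃ x₁ x₂, a x₁ * b i x₂ ≠ a x₂ * b i x₁)
    (ha : ∃ x₁ x₂, a x₁ ≠ a x₂) :
    ∃ v : α → ℝ, ∑ x, v x = 1 ∧ ∑ x, v x * a x = 0 ∧ ∀ i, ∑ x, v x * b i x ≠ 0 := by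
  -- The extra index `none` carries the coordinate sum, so that `v` can be normalised.
  obtain ⟨v, hv, hb⟩ := exists_sum_eq_zero_forall_sum_ne_zero (ι := Option ι) a
    (fun i => i.elim (fun _ => 1) b) (by
      rintro (_ | i)
      · simpa using ha
      · simpa using h i)
  have h1 : ∑ x, v x ≠ 0 := by simpa using hb none
  refine ⟨fun x => (∑ x, v x)⁻¹ * v x, ?_, ?_, fun i => ?_⟩
  · rw [← Finset.mul_sum, inv_mul_cancel₀ h1]
  · simp_rw [mul_assoc]
    rw [← Finset.mul_sum, hv, mul_zero]
  · simp_rw [mul_assoc]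
    rw [← Finset.mul_sum]
    exact mul_ne_zero (inv_ne_zero h1) (hb (some i))

/-! ### The rational relation and its nonvanishing -/

/-- The total weight `∑ {q e | f x e = y}` of the fibre of `f x` over `y`. -/
def fibreMass {A E B : Type*} [Fintype E] [DecidableEq B] (f : A → E → B) (q : E → ℝ)
    (x : A) (y : B) : ℝ :=
  ∑ e, q e * if f x e = y then 1 else 0

/-- The linear relation with weights `w` between the ratios `p x * a x y / ∑ x', p x' * a x' y`,
with denominators cleared. -/
def clearedRelation {A B : Type*} [Fintype A] [Fintype B] [DecidableEq B] (w a : A → B → ℝ)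
    (p : A → ℝ) : ℝ :=
  ∑ y, (∑ x, w x y * (p x * a x y)) * ∏ y' ∈ Finset.univ.erase y, ∑ x, p x * a x y'

/-- The matrix `a` has no zero entry, no two equal entries in one column `a · y`, and no vanishing
minor of size two. -/
structure IsNondegenerate {A B : Type*} (a : A → B → ℝ) : Prop where
  ne_zero : ∀ x y, a x y ≠ 0
  ne : ∀ x₁ x₂, x₁ ≠ x₂ → ∀ y, a x₁ y ≠ a x₂ y
  minor_ne : ∀ x₁ x₂, x₁ ≠ x₂ → ∀ y y', y ≠ y' → a x₁ y * a x₂ y' ≠ a x₂ y * a x₁ y'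

/-- If `p` annihilates column `y` of `a`, every summand except the one at `y` contains a zero
factor. The nonvanishing minors keep the other denominators nonzero, and `w x₁ y ≠ w x₂ y` does so
for the numerator. Signs of `p` are irrelevant: only the hyperplane matters. -/
theorem IsNondegenerate.exists_clearedRelation_ne_zero {A B : Type*} [Fintype A] [DecidableEq A]
    [Fintype B] [DecidableEq B] {a : A → B → ℝ} (ha : IsNondegenerate a) (w : A → B → ℝ)
    {x₁ x₂ : A} {y : B} (hw : w x₁ y ≠ w x₂ y) :
    ∃ p : A → ℝ, ∑ x, p x = 1 ∧ clearedRelation w a p ≠ 0 := by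
  have hx : x₁ ≠ x₂ := fun h => hw (by rw [h])
  obtain ⟨p, hp1, hp0, hp⟩ := exists_sum_eq_one_sum_eq_zero_forall_sum_ne_zero
    (ι := Option {y' // y' ≠ y}) (fun x => a x y)
    (fun i x => i.elim (w x y * a x y) (fun y' => a x y')) (by
      rintro (_ | ⟨y', hy'⟩)
      · refine ⟨x₁, x₂, fun h => hw ?_⟩
        have h1 := ha.ne_zero x₁ y
        have h2 := ha.ne_zero x₂ y
        simp only [Option.elim_none] at h
        apply mul_left_cancel₀ (mul_ne_zero h1 h2)
        linarith
      · exact ⟨x₁, x₂, ha.minor_ne x₁ x₂ hx y y' hy'.symm⟩)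
    ⟨x₁, x₂, ha.ne x₁ x₂ hx y⟩
  refine ⟨p, hp1, ?_⟩
  unfold clearedRelation
  rw [Finset.sum_eq_single y]
  · refine mul_ne_zero ?_ (Finset.prod_ne_zero_iff.2 fun y' hy' => ?_)
    · have := hp none
      simp only [Option.elim_none] at this
      convert this using 2 with x
      ring_nf
    · simpa using hp (some ⟨y', Finset.ne_of_mem_erase hy'⟩)
  · intro y' _ hy'
    rw [Finset.prod_eq_zero (Finset.mem_erase.2 ⟨hy'.symm, Finset.mem_univ y⟩) hp0, mul_zero]
  · simp

/-- Fewer than `n (n - 1)` maps `Fin n → Fin n` satisfy a common nontrivial rational relation. -/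
theorem exists_relation {n : ℕ} {E : Type*} (g : Fin n → E → Fin n) (s : Finset E)
    (hs : s.card < n * (n - 1)) :
    ∃ w : Fin n → Fin n → ℚ, (∃ x₁ x₂ y, w x₁ y ≠ w x₂ y) ∧ ∀ e ∈ s, ∑ y, w (g y e) y = 0 := by
  obtain _ | m := n
  · simp at hs
  -- Adding constants to columns of `w` is the trivial freedom. Fixing row `0` to zero removes it,
  -- leaving `n (n - 1)` unknowns, and any nonzero solution has a nonconstant column.
  let consZero : (Fin m → Fin (m + 1) → ℚ) →ₗ[ℚ] (Fin (m + 1) → Fin (m + 1) → ℚ) :=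
    { toFun := fun v => Fin.cons 0 v
      map_add' := by
        intro v v'
        ext i
        refine Fin.cases ?_ (fun j => ?_) i <;> simp
      map_smul' := by
        intro c v
        ext i
        refine Fin.cases ?_ (fun j => ?_) i <;> simp }
  let T : (Fin m → Fin (m + 1) → ℚ) →ₗ[ℚ] (s → ℚ) :=
    { toFun := fun v e => ∑ y, consZero v (g y e) y
      map_add' := by intro v v'; ext e; simp [Finset.sum_add_distrib]
      map_smul' := by intro c v; ext e; simp [Finset.mul_sum] }
  have hT : ¬ Function.Injective T := by
    intro h
    have := LinearMap.finrank_le_finrank_of_injective h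
    simp [Module.finrank_pi_fintype] at this
    simp at hs
    rw [mul_comm] at hs
    omega
  rw [← LinearMap.ker_eq_bot, Submodule.eq_bot_iff] at hT
  push Not at hT
  obtain ⟨v, hv, hv0⟩ := hT
  refine ⟨consZero v, ?_, fun e he => congrFun (LinearMap.mem_ker.1 hv) ⟨e, he⟩⟩
  obtain ⟨j, y, hjy⟩ : ∃ j y, v j y ≠ 0 := by
    by_contra! h
    exact hv0 (by ext j y; simpa using h j y)
  exact ⟨j.succ, 0, y, by simpa [consZero] using hjy⟩

/-- Proportional indicators of nonempty sets have ratio one, so the sets would coincide. -/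
theorem exists_indicator_mul_ne {E : Type*} {s t : E → Prop} [DecidablePred s] [DecidablePred t]
    (hs : {e | s e}.Nonempty) (ht : {e | t e}.Nonempty) (hst : {e | s e} ≠ {e | t e}) :
    ∃ e₁ e₂, (if s e₁ then 1 else 0 : ℝ) * (if t e₂ then 1 else 0) ≠
      (if s e₂ then 1 else 0) * (if t e₁ then 1 else 0) := by
  obtain ⟨e₁, h₁⟩ := hs
  obtain ⟨e₂, h₂⟩ := ht
  simp only [Set.mem_ofPred_eq] at h₁ h₂
  by_cases h : ∀ e, s e → t e
  · obtain ⟨e, het, hes⟩ : ∃ e, t e ∧ ¬ s e := by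
      by_contra! h'
      exact hst (Set.ext fun e => ⟨h e, h' e⟩)
    exact ⟨e₁, e, by simp [h₁, het, hes]⟩
  · push Not at h
    obtain ⟨e, hes, het⟩ := h
    exact ⟨e, e₂, by simp [h₂, hes, het]⟩

/-! ### Genericity gives nondegeneracy almost surely -/

theorem fibreMass_single {A E B : Type*} [Fintype E] [DecidableEq E] [DecidableEq B]
    (f : A → E → B) (e : E) (x : A) (y : B) :
    fibreMass f (Pi.single e 1) x y = if f x e = y then 1 else 0 := by
  unfold fibreMass
  rw [Finset.sum_eq_single e]
  · simp
  · intro b _ hb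
    simp [hb]
  · simp

/-- Almost every distribution of the exogenous variable gives a nondegenerate matrix of
fibre masses. -/
theorem IsGeneric.ae_isNondegenerate_fibreMass {A B : Type*} [Countable A] [Countable B]
    [DecidableEq B] {θ : ℕ} {f : A → Fin θ → B} (hf : IsGeneric f) :
    ∀ᵐ q ∂(uniformSimplex θ), IsNondegenerate (fibreMass f fun e => q e) := by
  let M : A → B → MvPolynomial (Fin θ) ℝ := fun x y =>
    ∑ e, MvPolynomial.X e * MvPolynomial.C (if f x e = y then 1 else 0)
  have hM : ∀ x y (q : Fin θ → ℝ), MvPolynomial.eval q (M x y) = fibreMass f q x y := by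
    intro x y q
    simp only [M, map_sum, map_mul, MvPolynomial.eval_X, MvPolynomial.eval_C, fibreMass]
  have h1 : ∀ᵐ q ∂(uniformSimplex θ), ∀ x y, fibreMass f (fun e => q e) x y ≠ 0 := by
    simp only [ae_all_iff]
    intro x y
    obtain ⟨e, he⟩ := hf.2 x y
    have := (M x y).ae_uniformSimplex_eval_ne_zero (Pi.single e 1) (by simp) (by
      rw [hM, fibreMass_single]
      simpa using he)
    simpa only [hM] using this
  have h2 : ∀ᵐ q ∂(uniformSimplex θ), ∀ x₁ x₂, x₁ ≠ x₂ → ∀ y,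
      fibreMass f (fun e => q e) x₁ y ≠ fibreMass f (fun e => q e) x₂ y := by
    simp only [ae_all_iff]
    intro x₁ x₂ hx y
    obtain ⟨e, he⟩ : ∃ e, ¬ (f x₁ e = y ↔ f x₂ e = y) := by
      by_contra! h
      exact hf.1 x₁ x₂ hx y (Set.ext h)
    have := (M x₁ y - M x₂ y).ae_uniformSimplex_eval_ne_zero (Pi.single e 1) (by simp) (by
      rw [map_sub, hM, hM, fibreMass_single, fibreMass_single]
      by_cases h : f x₁ e = y <;> by_cases h' : f x₂ e = y <;> simp_all)
    simpa only [map_sub, hM, sub_ne_zero] using this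
  have h3 : ∀ᵐ q ∂(uniformSimplex θ), ∀ x₁ x₂, x₁ ≠ x₂ → ∀ y y', y ≠ y' →
      fibreMass f (fun e => q e) x₁ y * fibreMass f (fun e => q e) x₂ y' ≠
        fibreMass f (fun e => q e) x₂ y * fibreMass f (fun e => q e) x₁ y' := by
    simp only [ae_all_iff]
    intro x₁ x₂ hx y y' hy
    -- At `q₀` the mass of `(x₁, y)` vanishes while those of `(x₂, y)` and `(x₁, y')` do not, so one
    -- product in the minor survives.
    obtain ⟨q₀, hq₀, hzero, hne⟩ := exists_sum_eq_one_sum_eq_zero_forall_sum_ne_zero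
      (fun e => if f x₁ e = y then (1 : ℝ) else 0)
      (fun i : Bool => if i then fun e => if f x₂ e = y then (1 : ℝ) else 0
        else fun e => if f x₁ e = y' then (1 : ℝ) else 0) (by
        rintro (_ | _)
        · exact exists_indicator_mul_ne (s := fun e => f x₁ e = y) (t := fun e => f x₁ e = y')
            (hf.2 x₁ y) (hf.2 x₁ y') fun h => by
            obtain ⟨e, he⟩ := hf.2 x₁ y
            have he' : e ∈ {e | f x₁ e = y'} := h ▸ he
            exact hy (he.symm.trans he')
        · exact exists_indicator_mul_ne (s := fun e => f x₁ e = y) (t := fun e => f x₂ e = y)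
            (hf.2 x₁ y) (hf.2 x₂ y) (hf.1 x₁ x₂ hx y)) (by
        obtain ⟨e₁, h1⟩ := hf.2 x₁ y
        obtain ⟨e₂, h2⟩ := hf.2 x₁ y'
        refine ⟨e₁, e₂, ?_⟩
        simp only [Set.mem_ofPred_eq] at h1 h2
        simp [h1, h2, hy.symm])
    have := (M x₁ y * M x₂ y' - M x₂ y * M x₁ y').ae_uniformSimplex_eval_ne_zero q₀ hq₀ (by
      rw [map_sub, map_mul, map_mul, hM, hM, hM, hM, show fibreMass f q₀ x₁ y = 0 from hzero,
        zero_mul, zero_sub, neg_ne_zero]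
      exact mul_ne_zero (hne true) (hne false))
    simpa only [map_sub, map_mul, hM, sub_ne_zero] using this
  filter_upwards [h1, h2, h3] with q h1 h2 h3
  exact ⟨h1, h2, h3⟩

/-- For almost every pair of distributions, the ratios `p x * a x y / ∑ x', p x' * a x' y` with
`a` the fibre masses satisfy no nontrivial rational linear relation. -/
theorem IsGeneric.ae_clearedRelation_ne_zero {n θ : ℕ} {B : Type*} [Fintype B] [DecidableEq B]
    {f : Fin n → Fin θ → B} (hf : IsGeneric f) :
    ∀ᵐ pq ∂((uniformSimplex n).prod (uniformSimplex θ)), ∀ w : Fin n → B → ℚ,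
      (∃ x₁ x₂ y, w x₁ y ≠ w x₂ y) →
        clearedRelation (fun x y => (w x y : ℝ)) (fibreMass f fun e => pq.2 e)
          (fun x => pq.1 x) ≠ 0 := by
  have : IsFiniteMeasure (uniformSimplex n) := by unfold uniformSimplex; infer_instance
  have : IsFiniteMeasure (uniformSimplex θ) := by unfold uniformSimplex; infer_instance
  simp only [ae_all_iff]
  intro w ⟨x₁, x₂, y, hw⟩
  have hmeas : MeasurableSet {pq : EuclideanSpace ℝ (Fin n) × EuclideanSpace ℝ (Fin θ) |
      clearedRelation (fun x y => (w x y : ℝ)) (fibreMass f fun e => pq.2 e)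
        (fun x => pq.1 x) ≠ 0} := by
    unfold clearedRelation fibreMass
    exact (isOpen_ne_fun (by fun_prop) (by fun_prop)).measurableSet
  -- Fixing `q` first makes the relation a polynomial in `p` alone.
  rw [Measure.ae_prod_iff_ae_ae hmeas, Measure.ae_ae_comm hmeas]
  filter_upwards [hf.ae_isNondegenerate_fibreMass] with q hq
  obtain ⟨p₀, hp₀, hne⟩ := hq.exists_clearedRelation_ne_zero (fun x y => (w x y : ℝ))
    (x₁ := x₁) (x₂ := x₂) (y := y) (by exact_mod_cast hw)
  set a := fibreMass f fun e => q e
  let R : MvPolynomial (Fin n) ℝ := 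
    ∑ y, (∑ x, MvPolynomial.C (w x y : ℝ) * (MvPolynomial.X x * MvPolynomial.C (a x y))) *
      ∏ y' ∈ Finset.univ.erase y, ∑ x, MvPolynomial.X x * MvPolynomial.C (a x y')
  have hR : ∀ p : Fin n → ℝ, MvPolynomial.eval p R =
      clearedRelation (fun x y => (w x y : ℝ)) a p := by
    intro p
    simp only [R, clearedRelation, map_sum, map_mul, map_prod, MvPolynomial.eval_X,
      MvPolynomial.eval_C]
  have := R.ae_uniformSimplex_eval_ne_zero p₀ hp₀ (by rwa [hR])
  simpa only [hR] using this

/-! ### From a small reverse model to a relation -/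

theorem IsCausalModel.real_inter_eq_mul {Ω A E B : Type*} [MeasurableSpace Ω] [MeasurableSpace A]
    [MeasurableSingletonClass A] [MeasurableSpace E] [MeasurableSingletonClass E]
    [MeasurableSpace B] [DecidableEq B]
    {P : Measure Ω} [IsProbabilityMeasure P] {C : Ω → A} {U : Ω → E} {D : Ω → B} {f : A → E → B}
    (h : IsCausalModel P C U D f) (s : Finset E) (hs : ∀ᵐ ω ∂P, U ω ∈ s) (x : A) (y : B) :
    P.real {ω | C ω = x ∧ D ω = y} =
      P.real {ω | C ω = x} * ∑ e ∈ s, P.real {ω | U ω = e} * if f x e = y then 1 else 0 := by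
  have hset : P.real {ω | C ω = x ∧ D ω = y} =
      P.real ({ω | C ω = x} ∩ {ω | U ω ∈ s.filter fun e => f x e = y}) := by
    apply measureReal_congr
    filter_upwards [hs, h.effect_eq] with ω hω hD
    apply propext
    change (C ω = x ∧ D ω = y) ↔ (C ω = x ∧ U ω ∈ s.filter fun e => f x e = y)
    rw [Finset.mem_filter, hD]
    constructor
    · rintro ⟨rfl, h2⟩
      exact ⟨rfl, hω, h2⟩
    · rintro ⟨rfl, -, h2⟩
      exact ⟨rfl, h2⟩
  have hind : P.real ({ω | C ω = x} ∩ {ω | U ω ∈ s.filter fun e => f x e = y}) =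
      P.real {ω | C ω = x} * P.real {ω | U ω ∈ s.filter fun e => f x e = y} := by
    have := h.indep.measure_inter_preimage_eq_mul {x} (↑(s.filter fun e => f x e = y) : Set E)
      (measurableSet_singleton x) (Finset.measurableSet _)
    simp only [Measure.real, ← ENNReal.toReal_mul]
    exact congrArg ENNReal.toReal this
  rw [hset, hind]
  congr 1
  have hsum := sum_measureReal_preimage_singleton (μ := P) (f := U) (s.filter fun e => f x e = y)
    (fun e _ => h.measurable_exogenous (measurableSet_singleton e))
  simp only [mul_ite, mul_one, mul_zero, ← Finset.sum_filter]
  exact hsum.symm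

/-- Substituting `h` turns the sum into the product of all denominators times `∑ e ∈ s, r e * ∑ y, w
(g y e) y`. Nothing is divided, so vanishing denominators are harmless. -/
theorem clearedRelation_eq_zero {n : ℕ} {E : Type*} (w : Fin n → Fin n → ℝ)
    (a : Fin n → Fin n → ℝ) (p : Fin n → ℝ) (s : Finset E) (g : Fin n → E → Fin n) (r : E → ℝ)
    (hw : ∀ e ∈ s, ∑ y, w (g y e) y = 0)
    (h : ∀ x y, p x * a x y =
      (∑ x', p x' * a x' y) * ∑ e ∈ s, r e * if g y e = x then 1 else 0) :
    clearedRelation w a p = 0 := by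
  have h1 : ∀ y, (∑ x, w x y * (p x * a x y)) *
      ∏ y' ∈ Finset.univ.erase y, ∑ x, p x * a x y' =
      (∏ y', ∑ x, p x * a x y') * ∑ e ∈ s, r e * w (g y e) y := by
    intro y
    have h2 : ∑ x, w x y * (p x * a x y) =
        (∑ x', p x' * a x' y) * ∑ e ∈ s, r e * w (g y e) y := by
      calc ∑ x, w x y * (p x * a x y)
          = ∑ x, (∑ x', p x' * a x' y) * ∑ e ∈ s, w x y * (r e * if g y e = x then 1 else 0) := by
            refine Finset.sum_congr rfl fun x _ => ?_
            rw [h x y, ← Finset.mul_sum]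
            ring
        _ = _ := by
            rw [← Finset.mul_sum, Finset.sum_comm]
            congr 1
            refine Finset.sum_congr rfl fun e _ => ?_
            simp [mul_comm]
    rw [h2, ← Finset.mul_prod_erase Finset.univ _ (Finset.mem_univ y)]
    ring
  unfold clearedRelation
  simp_rw [h1]
  rw [← Finset.mul_sum, Finset.sum_comm]
  rw [Finset.sum_eq_zero fun e he => ?_, mul_zero]
  rw [← Finset.mul_sum, hw e he, mul_zero]

/-- For almost every pair `(p, q)` of independent uniformly distributed probability vectors: if
`X ∼ p` and `E₀ ∼ q` are independent and `Y = f(X, E₀)` with `f` generic, then for every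
`(X', Y')` with the joint distribution of `(X, Y)` and every `E'` independent of `Y'` with
`X' = g(Y', E')`, every set of states that contains `E'` almost surely has at least `n (n - 1)`
elements. -/
theorem theorem1 (n θ : ℕ) (f : Fin n → Fin θ → Fin n) (hf : IsGeneric f) :
    ∀ᵐ pq ∂((uniformSimplex n).prod (uniformSimplex θ)),
      ∀ (Ω : Type*) [MeasurableSpace Ω] (P : Measure Ω) [IsProbabilityMeasure P]
        (X : Ω → Fin n) (E₀ : Ω → Fin θ) (Y : Ω → Fin n),
        IsCausalModel P X E₀ Y f →
        HasDistribution P X pq.1 →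
        HasDistribution P E₀ pq.2 →
        ∀ (Ω' : Type*) [MeasurableSpace Ω'] (P' : Measure Ω') [IsProbabilityMeasure P']
          (E : Type*) [MeasurableSpace E] [MeasurableSingletonClass E]
          (X' : Ω' → Fin n) (Y' : Ω' → Fin n) (E' : Ω' → E) (g : Fin n → E → Fin n),
          IdentDistrib (fun ω => (X' ω, Y' ω)) (fun ω => (X ω, Y ω)) P' P →
          IsCausalModel P' Y' E' X' g →
          ∀ S : Set E, (∀ᵐ ω ∂P', E' ω ∈ S) → ((n * (n - 1) : ℕ) : ℕ∞) ≤ S.encard := by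
  filter_upwards [hf.ae_clearedRelation_ne_zero] with pq hpq
  intro Ω _ P _ X E₀ Y hXY hX hE₀ Ω' _ P' _ E _ _ X' Y' E' g hid hYX S hS
  by_contra! hlt
  have hfin : S.Finite := Set.finite_of_encard_le_coe hlt.le
  obtain ⟨s, rfl⟩ := hfin.exists_finset_coe
  rw [Set.encard_coe_eq_coe_finsetCard, Nat.cast_lt] at hlt
  obtain ⟨w, hne, hw⟩ := exists_relation g s hlt
  refine hpq w hne (clearedRelation_eq_zero _ _ _ s g (fun e => P'.real {ω | E' ω = e}) ?_ ?_)
  · intro e he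
    exact_mod_cast hw e he
  have hjoint : ∀ x y, P'.real {ω | Y' ω = y ∧ X' ω = x} =
      pq.1 x * fibreMass f (fun e => pq.2 e) x y := by
    intro x y
    have h1 := hXY.real_inter_eq_mul Finset.univ (by simp) x y
    rw [hX x] at h1
    simp only [hE₀ _] at h1
    rw [fibreMass, ← h1]
    have h2 := hid.measure_mem_eq (measurableSet_singleton (x, y))
    have h3 : {ω | Y' ω = y ∧ X' ω = x} = (fun ω => (X' ω, Y' ω)) ⁻¹' {(x, y)} := by
      ext ω
      simp [and_comm]
    have h4 : {ω | X ω = x ∧ Y ω = y} = (fun ω => (X ω, Y ω)) ⁻¹' {(x, y)} := by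
      ext ω
      simp
    rw [h3, h4]
    exact congrArg ENNReal.toReal h2
  -- The denominators are the marginal probabilities of `Y'`.
  have hmarginal : ∀ y, P'.real {ω | Y' ω = y} =
      ∑ x, pq.1 x * fibreMass f (fun e => pq.2 e) x y := by
    intro y
    simp_rw [← hjoint]
    have h1 := sum_measureReal_preimage_singleton (μ := P'.restrict {ω | Y' ω = y}) (f := X')
      Finset.univ (fun x _ => hYX.measurable_effect (measurableSet_singleton x))
    rw [Finset.coe_univ, Set.preimage_univ, measureReal_restrict_apply MeasurableSet.univ,
      Set.univ_inter] at h1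
    rw [← h1]
    refine Finset.sum_congr rfl fun x _ => ?_
    rw [measureReal_restrict_apply (hYX.measurable_effect (measurableSet_singleton x))]
    congr 1
    ext ω
    simp [and_comm]
  intro x y
  rw [← hjoint, ← hmarginal]
  exact hYX.real_inter_eq_mul s hS y x
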